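/- A list assignment $L$ of a graph $G$ assigns to each vertex $v$ a finite set $L(v)$ of colors; $G$ is $k$-choosable if for every list assignment $L$ with $|L(v)|\ge k$ for all $v$ there is a proper coloring of $G$ in which each vertex $v$ receives a color from $L(v)$. The choice number $Ch(G)$ is the smallest $k$ such that $G$ is $k$-choosable. Theorem. For every integer $k\ge 6$, let $G=K_{4,3*2,2*(k-6),1*3}$ be the complete $k$-partite graph with one part of size $4$, two parts of size $3$, $k-6$ parts of size $2$ and three parts of size $1$. Then $Ch(G)=k$. -/

import Mathlib

universe u

namespace SimpleGraph

/-- `G` is `L`-colorable: there is a proper coloring of `G` in which every vertex `v` receives a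
color from its own list `L v`. -/
def ListColorable {V : Type u} {C : Type u} (G : SimpleGraph V) (L : V → Finset C) : Prop :=
  ∃ c : G.Coloring C, ∀ v, c v ∈ L v

/-- `G` is `k`-choosable: `G` is `L`-colorable for every list assignment `L`, with colors from an
arbitrary type, all of whose lists have at least `k` elements. -/
def Choosable {V : Type u} (G : SimpleGraph V) (k : ℕ) : Prop :=
  ∀ (C : Type u) (L : V → Finset C), (∀ v, k ≤ (L v).card) → G.ListColorable L

/-- The choice number of `G`: the smallest `k` such that `G` is `k`-choosable
(and `⊤` if there is no such `k`). -/
noncomputable def choiceNumber {V : Type u} (G : SimpleGraph V) : ℕ∞ :=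
  ⨅ (k : ℕ) (_ : G.Choosable k), (k : ℕ∞)

/-- The complete multipartite graph whose parts have the sizes listed in `l`: it has one part,
with `l.get i` vertices, for each position `i` of `l`. -/
abbrev completeMultipartiteOfSizes (l : List ℕ) :
    SimpleGraph (Σ i : Fin l.length, Fin (l.get i)) :=
  completeMultipartiteGraph fun i : Fin l.length => Fin (l.get i)

end SimpleGraph

/-!
The lower bound holds because the graph contains a clique on `k` vertices. For the upper bound,
the argument covers all complete `k`-partite graphs whose parts have at most four vertices, with
exactly three parts of size one, `b ≤ 2` parts of size three and `a ≤ 1` part of size four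
(`IsAdmissible`), by induction on the number of parts. Lists may be assumed to have exactly `k`
colors. There are two reductions. By Kierstead's lemma (`hasListColoring_of_few_colors`) the lists
use in total fewer colors than there are vertices, that is, at most `2 * k - 4 + b + 2 * a ≤ 2 *
k` colors. And if all lists of a part of size at least two share a color, then that part is
colored with it, and induction applies to the other parts with this color removed.

So no color is common to a part of size at least two. Now every such part is divided into two
color classes; a class may be colored with any color common to the lists of its vertices. The two
vertices of a part of size two form separate classes, with disjoint lists. A part of size three is
divided into a single vertex and a pair, a part of size four into a single vertex and a triple, or
into two pairs when no color lies on three of its lists. In all cases the two classes of a part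
have disjoint sets of available colors. A system of distinct representatives for the classes is a
proper coloring, so Hall's condition has to be checked (`card_add_card_le_of_classes`). A set of
classes that contains a vertex forming a class by itself sees at least `k` colors, and its size is
at most `k` plus the number of parts with both classes in the set. If one of these parts has size
two, then `2 * k` colors are seen, which is enough. Otherwise there are at most three such parts,
all of size three or four, and what is needed is that they bring in a few additional colors. Since
the number of colors is small, inclusion and exclusion gives at least six colors lying on two
lists of a part of size three (`le_sum_card_others`), so the divisions of these parts can be
chosen to leave enough room (`exists_split_two_triples`). If no color lies on three lists of the
part of size four, then every color lies on exactly two of them, and a suitable division into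
pairs exists (`exists_pairing_of_no_triple`).
-/

namespace ListColoring

open Finset

/-! ### Hall's theorem and Kierstead's reduction -/

section Hall

variable {α C : Type*} [DecidableEq α] [DecidableEq C]

/-- Hall's theorem for the members of a finite set `W`. -/
lemma exists_injOn_of_hall [Nonempty C] (W : Finset α) (t : α → Finset C)
    (h : ∀ S ⊆ W, #S ≤ #(S.biUnion t)) :
    ∃ f : α → C, (∀ v ∈ W, f v ∈ t v) ∧ Set.InjOn f W := by
  have key : ∀ s : Finset W, #s ≤ #(s.biUnion fun v => t v) := by
    intro s
    have h1 := h (s.map (Function.Embedding.subtype _)) (by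
      intro x hx
      obtain ⟨y, -, rfl⟩ := mem_map.1 hx
      exact y.2)
    rw [card_map] at h1
    refine h1.trans (card_le_card ?_)
    intro c hc
    simp only [mem_biUnion, mem_map, Function.Embedding.coe_subtype] at hc ⊢
    obtain ⟨_, ⟨y, hy, rfl⟩, hc⟩ := hc
    exact ⟨y, hy, hc⟩
  obtain ⟨f, hf, hft⟩ := (all_card_le_biUnion_card_iff_exists_injective _).1 key
  refine ⟨fun v => if hv : v ∈ W then f ⟨v, hv⟩ else Classical.arbitrary C, ?_, ?_⟩
  · intro v hv
    simpa [hv] using hft ⟨v, hv⟩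
  · intro u hu v hv huv
    have hu' : u ∈ W := hu
    have hv' : v ∈ W := hv
    simp only [hu', hv', dif_pos] at huv
    simpa using hf huv

/-- Hall's theorem for a family in which every index in `I` carries a first set `A i`, and every
index in `J` also carries a second set `B i`. -/
lemma exists_transversal_of_hall [Nonempty C] (I J : Finset α) (A B : α → Finset C)
    (h : ∀ S ⊆ I, ∀ T ⊆ J, #S + #T ≤ #(S.biUnion A ∪ T.biUnion B)) :
    ∃ f g : α → C, (∀ i ∈ I, f i ∈ A i) ∧ (∀ i ∈ J, g i ∈ B i) ∧ Set.InjOn f I ∧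
      Set.InjOn g J ∧ ∀ i ∈ I, ∀ j ∈ J, f i ≠ g j := by
  obtain ⟨F, hF, hinj⟩ := exists_injOn_of_hall (I.disjSum J) (Sum.elim A B) (by
    intro S hS
    have h1 := h S.toLeft (fun i hi => by simpa using hS (mem_toLeft.1 hi)) S.toRight
      (fun i hi => by simpa using hS (mem_toRight.1 hi))
    rw [card_toLeft_add_card_toRight] at h1
    refine h1.trans (card_le_card ?_)
    intro c hc
    simp only [mem_union, mem_biUnion, mem_toLeft, mem_toRight] at hc ⊢
    rcases hc with ⟨i, hi, hc⟩ | ⟨i, hi, hc⟩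
    · exact ⟨_, hi, hc⟩
    · exact ⟨_, hi, hc⟩)
  refine ⟨fun i => F (.inl i), fun i => F (.inr i), ?_, ?_, ?_, ?_, ?_⟩
  · intro i hi
    exact hF (.inl i) (by simpa using hi)
  · intro i hi
    exact hF (.inr i) (by simpa using hi)
  · intro i hi j hj hij
    simpa using hinj (by simpa using hi) (by simpa using hj) hij
  · intro i hi j hj hij
    simpa using hinj (by simpa using hi) (by simpa using hj) hij
  · intro i hi j hj hij
    have := hinj (x₁ := .inl i) (x₂ := .inr j) (by simpa using hi) (by simpa using hj) hij
    simp at this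

end Hall

section Reduction

variable {V ι C : Type*}

/-- The complete multipartite graph on `W`, with the fibres of `p` as parts, has a proper coloring
from the lists `L`. -/
def HasListColoring (p : V → ι) (W : Finset V) (L : V → Finset C) : Prop :=
  ∃ c : V → C, (∀ v ∈ W, c v ∈ L v) ∧ ∀ u ∈ W, ∀ v ∈ W, p u ≠ p v → c u ≠ c v

lemma HasListColoring.mono {p : V → ι} {W : Finset V} {L L' : V → Finset C}
    (h : HasListColoring p W L) (hL : ∀ v ∈ W, L v ⊆ L' v) : HasListColoring p W L' := by
  obtain ⟨c, hc, hp⟩ := h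
  exact ⟨c, fun v hv => hL v hv (hc v hv), hp⟩

/-- Kierstead's reduction: it is enough to color from lists with fewer colors in total than there
are vertices. If Hall's condition fails, then a maximal violating set `X` sees fewer than `#X`
colors, and by maximality the vertices outside `X` have distinct representatives among the colors
that `X` does not see. -/
lemma hasListColoring_of_few_colors [DecidableEq V] [DecidableEq C] [Nonempty C] (p : V → ι)
    (W : Finset V) (k : ℕ)
    (H : ∀ L : V → Finset C, (∀ v ∈ W, #(L v) = k) → #(W.biUnion L) < #W →
      HasListColoring p W L)
    (L : V → Finset C) (hL : ∀ v ∈ W, #(L v) = k) : HasListColoring p W L := by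
  by_cases hall : ∀ S ⊆ W, #S ≤ #(S.biUnion L)
  · obtain ⟨f, hf, hinj⟩ := exists_injOn_of_hall W L hall
    exact ⟨f, hf, fun u hu v hv huv h => huv (congrArg p (hinj hu hv h))⟩
  push Not at hall
  obtain ⟨S, hSW, hS⟩ := hall
  obtain ⟨X, -, hX⟩ := (W.powerset.filter fun S => #(S.biUnion L) < #S).exists_le_maximal
    (a := S) (by simp [hSW, hS])
  obtain ⟨hXW, hXL⟩ : X ⊆ W ∧ #(X.biUnion L) < #X := by simpa using hX.prop
  obtain ⟨x, hx⟩ : X.Nonempty := card_pos.1 (by omega)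
  have hcol : HasListColoring p W (fun v => if v ∈ X then L v else L x) := by
    apply H
    · intro v hv
      split_ifs
      · exact hL v hv
      · exact hL x (hXW hx)
    · refine lt_of_le_of_lt (card_le_card ?_) (hXL.trans_le (card_le_card hXW))
      intro c hc
      obtain ⟨v, -, hc⟩ := mem_biUnion.1 hc
      split_ifs at hc with h
      · exact mem_biUnion.2 ⟨v, h, hc⟩
      · exact mem_biUnion.2 ⟨x, hx, hc⟩
  obtain ⟨c, hc, hcp⟩ := hcol
  obtain ⟨f, hf, hinj⟩ := exists_injOn_of_hall (W \ X) (fun v => L v \ X.biUnion L) (by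
    intro Y hY
    by_contra hlt
    push Not at hlt
    have hYX : Disjoint X Y := by
      rw [disjoint_right]
      exact fun v hv => (mem_sdiff.1 (hY hv)).2
    have hmem : X ∪ Y ∈ W.powerset.filter fun S => #(S.biUnion L) < #S := by
      simp only [mem_filter, mem_powerset]
      refine ⟨union_subset hXW fun v hv => (mem_sdiff.1 (hY hv)).1, ?_⟩
      rw [card_union_of_disjoint hYX]
      have : (X ∪ Y).biUnion L ⊆ X.biUnion L ∪ Y.biUnion (fun v => L v \ X.biUnion L) := by
        intro d hd
        by_cases hdX : d ∈ X.biUnion L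
        · exact mem_union_left _ hdX
        · obtain ⟨v, hv, hdv⟩ := mem_biUnion.1 hd
          rcases mem_union.1 hv with hv | hv
          · exact absurd (mem_biUnion.2 ⟨v, hv, hdv⟩) hdX
          · exact mem_union_right _ (mem_biUnion.2 ⟨v, hv, mem_sdiff.2 ⟨hdv, hdX⟩⟩)
      have := (card_le_card this).trans (card_union_le _ _)
      omega
    have hle := hX.le_of_ge hmem (subset_union_left)
    have hY0 : Y = ∅ := by
      rw [eq_empty_iff_forall_notMem]
      exact fun v hv => disjoint_right.1 hYX hv (hle (mem_union_right _ hv))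
    simp [hY0] at hlt)
  have hcX : ∀ v ∈ X, c v ∈ L v := fun v hv => by simpa [hv] using hc v (hXW hv)
  have hfX : ∀ v ∈ W, v ∉ X → f v ∈ L v ∧ f v ∉ X.biUnion L := fun v hv hvX =>
    mem_sdiff.1 (hf v (mem_sdiff.2 ⟨hv, hvX⟩))
  refine ⟨fun v => if v ∈ X then c v else f v, ?_, ?_⟩
  · intro v hv
    dsimp only
    split_ifs with h
    · exact hcX v h
    · exact (hfX v hv h).1
  · intro u hu v hv huv
    dsimp only
    split_ifs with h1 h2 h2
    · exact hcp u hu v hv huv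
    · intro he
      exact (hfX v hv h2).2 (he ▸ mem_biUnion.2 ⟨u, h1, hcX u h1⟩)
    · intro he
      exact (hfX u hu h1).2 (he ▸ mem_biUnion.2 ⟨v, h2, hcX v h2⟩)
    · intro he
      exact huv (congrArg p (hinj (mem_coe.2 (mem_sdiff.2 ⟨hu, h1⟩))
        (mem_coe.2 (mem_sdiff.2 ⟨hv, h2⟩)) he))

end Reduction

/-! ### Color classes inside a part -/

section Splitting

variable {V C : Type*}

/-- Any two colors taken from `A` and from `B` suffice to color the part `P` from the lists `L`. -/
def ColoredByPair (P : Finset V) (L : V → Finset C) (A B : Finset C) : Prop :=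
  ∀ α ∈ A, ∀ β ∈ B, ∀ v ∈ P, α ∈ L v ∨ β ∈ L v

variable [DecidableEq C]

lemma lt_card_union_of_ne {A B : Finset C} {n : ℕ} (hA : #A = n) (hB : #B = n) (h : A ≠ B) :
    n < #(A ∪ B) := by
  by_contra hlt
  push Not at hlt
  have h1 := eq_of_subset_of_card_le (subset_union_left : A ⊆ A ∪ B) (by omega)
  have h2 := eq_of_subset_of_card_le (subset_union_right : B ⊆ A ∪ B) (by omega)
  exact h (h1.trans h2.symm)

/-- The colors common to the two lists other than `L i`, among three lists. -/
def others (L : Fin 3 → Finset C) (i : Fin 3) : Finset C := L (i + 1) ∩ L (i + 2)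

lemma mem_others {L : Fin 3 → Finset C} {i : Fin 3} {c : C} :
    c ∈ others L i ↔ ∀ j, j ≠ i → c ∈ L j := by
  simp only [others, mem_inter]
  fin_cases i <;> simp only [Fin.forall_fin_succ] <;> simp [and_comm (a := c ∈ L 0)]

lemma disjoint_others {L : Fin 3 → Finset C} (hL : ∀ c, ¬ ∀ i, c ∈ L i) (i : Fin 3) :
    Disjoint (L i) (others L i) := by
  rw [disjoint_left]
  intro c hc hc'
  rw [mem_others] at hc'
  refine hL c fun j => ?_
  by_cases h : j = i
  · exact h ▸ hc
  · exact hc' j h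

lemma disjoint_others_others {L : Fin 3 → Finset C} (hL : ∀ c, ¬ ∀ i, c ∈ L i) {i j : Fin 3}
    (hij : i ≠ j) : Disjoint (others L i) (others L j) := by
  rw [disjoint_left]
  intro c hc hc'
  exact disjoint_left.1 (disjoint_others hL i) (mem_others.1 hc' i hij) hc

lemma union_others_inter_subset (L : Fin 3 → Finset C) {i j : Fin 3} (hij : i ≠ j) :
    (L i ∪ others L i) ∩ (L j ∪ others L j) ⊆ others L 0 ∪ others L 1 ∪ others L 2 := by
  intro c hc
  simp only [mem_inter, mem_union, others] at hc ⊢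
  fin_cases i <;> fin_cases j <;> simp_all <;> tauto

/-- By inclusion and exclusion, many colors appear on exactly two of three lists of size `k`. -/
lemma le_sum_card_others {L : Fin 3 → Finset C} {U : Finset C} {k : ℕ} (hk : ∀ i, #(L i) = k)
    (hU : ∀ i, L i ⊆ U) :
    3 * k ≤ #U + (#(others L 0) + #(others L 1) + #(others L 2)) := by
  have h1 := card_union_add_card_inter (L 0) (L 1)
  have h2 := card_union_add_card_inter (L 0 ∪ L 1) (L 2)
  have h3 : #((L 0 ∪ L 1) ∩ L 2) ≤ #(L 0 ∩ L 2) + #(L 1 ∩ L 2) := by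
    rw [union_inter_distrib_right]
    exact card_union_le _ _
  have h4 : #(L 0 ∪ L 1 ∪ L 2) ≤ #U :=
    card_le_card (union_subset (union_subset (hU 0) (hU 1)) (hU 2))
  have e0 : others L 0 = L 1 ∩ L 2 := rfl
  have e1 : others L 1 = L 0 ∩ L 2 := inter_comm _ _
  have e2 : others L 2 = L 0 ∩ L 1 := rfl
  rw [e0, e1, e2]
  have := hk 0
  have := hk 1
  have := hk 2
  omega

lemma exists_two_le_card_others {L : Fin 3 → Finset C}
    (h : 6 ≤ #(others L 0) + #(others L 1) + #(others L 2)) : ∃ i, 2 ≤ #(others L i) := by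
  by_contra! hlt
  have := hlt 0
  have := hlt 1
  have := hlt 2
  omega

lemma card_union_others {L : Fin 3 → Finset C} (hL : ∀ c, ¬ ∀ i, c ∈ L i) {k : ℕ}
    (hk : ∀ i, #(L i) = k) (i : Fin 3) : #(L i ∪ others L i) = k + #(others L i) := by
  rw [card_union_of_disjoint (disjoint_others hL i), hk]

/-- In each of two parts of size three, one vertex can be split off so that the resulting classes
satisfy Hall's condition with some room. If one of the sets `others L i`, `others L' j` has
at least three elements this is immediate. Otherwise all six of them have size two, and, for any
fixed `j`, each of the two ways to fail excludes at most one of the three choices of `i`. -/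
lemma exists_split_two_triples {L L' : Fin 3 → Finset C} (hL : ∀ c, ¬ ∀ i, c ∈ L i)
    (hL' : ∀ c, ¬ ∀ i, c ∈ L' i) {k : ℕ} (hk5 : 5 ≤ k) (hk : ∀ i, #(L i) = k)
    (hk' : ∀ i, #(L' i) = k) (h : 6 ≤ #(others L 0) + #(others L 1) + #(others L 2))
    (h' : 6 ≤ #(others L' 0) + #(others L' 1) + #(others L' 2)) :
    ∃ i j, 2 ≤ #(others L i) ∧ 2 ≤ #(others L' j) ∧
      k + 3 ≤ #((L i ∪ others L i) ∪ (L' j ∪ others L' j)) ∧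
      3 ≤ #(others L i ∪ others L' j) := by
  by_cases h3 : ∃ i, 3 ≤ #(others L i)
  · obtain ⟨i, hi⟩ := h3
    obtain ⟨j, hj⟩ := exists_two_le_card_others h'
    refine ⟨i, j, by omega, hj, ?_, hi.trans (card_le_card subset_union_left)⟩
    refine le_trans ?_ (card_le_card subset_union_left)
    rw [card_union_others hL hk]
    omega
  by_cases h3' : ∃ j, 3 ≤ #(others L' j)
  · obtain ⟨j, hj⟩ := h3'
    obtain ⟨i, hi⟩ := exists_two_le_card_others h
    refine ⟨i, j, hi, by omega, ?_, hj.trans (card_le_card subset_union_right)⟩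
    refine le_trans ?_ (card_le_card subset_union_right)
    rw [card_union_others hL' hk']
    omega
  push Not at h3 h3'
  have c2 : ∀ i, #(others L i) = 2 := by
    have := h3 0
    have := h3 1
    have := h3 2
    intro i
    fin_cases i <;> simp <;> omega
  have c2' : #(others L' 0) = 2 := by
    have := h3' 0
    have := h3' 1
    have := h3' 2
    omega
  have hne : ∀ i j, i ≠ j → others L i ≠ others L j := by
    intro i j hij he
    have := disjoint_others_others hL hij
    rw [he, disjoint_self, bot_eq_empty] at this
    simpa [this] using c2 j
  have hneR : ∀ R : Finset C, ∀ i j, i ≠ j → ¬ (L i ∪ others L i = R ∧ L j ∪ others L j = R) := by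
    rintro R i j hij ⟨rfl, hR⟩
    have h1 := card_le_card (union_others_inter_subset L hij)
    rw [hR, inter_self, card_union_others hL hk, c2] at h1
    have h2 := card_union_le (others L 0 ∪ others L 1) (others L 2)
    have h4 := card_union_le (others L 0) (others L 1)
    rw [c2, c2] at h4
    rw [c2] at h2
    omega
  obtain ⟨i, hi1, hi2⟩ : ∃ i, others L i ≠ others L' 0 ∧
      L i ∪ others L i ≠ L' 0 ∪ others L' 0 := by
    by_contra! hcon
    have key : ∀ i j, i ≠ j → others L i = others L' 0 → others L j ≠ others L' 0 :=
      fun i j hij e1 e2 => hne i j hij (e1.trans e2.symm)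
    have key' : ∀ i j, i ≠ j → L i ∪ others L i = L' 0 ∪ others L' 0 →
        L j ∪ others L j ≠ L' 0 ∪ others L' 0 :=
      fun i j hij e1 e2 => hneR _ i j hij ⟨e1, e2⟩
    by_cases e0 : others L 0 = others L' 0
    · exact key' 1 2 (by decide) (hcon 1 (key 0 1 (by decide) e0))
        (hcon 2 (key 0 2 (by decide) e0))
    · by_cases e1 : others L 1 = others L' 0
      · exact key' 0 2 (by decide) (hcon 0 e0) (hcon 2 (key 1 2 (by decide) e1))
      · exact key' 0 1 (by decide) (hcon 0 e0) (hcon 1 e1)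
  refine ⟨i, 0, (c2 i).ge, c2'.ge, ?_, lt_card_union_of_ne (c2 i) c2' hi1⟩
  exact lt_card_union_of_ne (n := k + 2) (by rw [card_union_others hL hk, c2])
    (by rw [card_union_others hL' hk', c2']) hi2

/-- If four lists of size `k` use at most `2 * k` colors, and no color lies on three of them, then
there are `2 * k` colors and every color lies on exactly two of the lists. -/
lemma subset_union_of_no_triple {a b c d U : Finset C} {k : ℕ} (ha : #a = k) (hb : #b = k)
    (hc : #c = k) (hd : #d = k) (haU : a ⊆ U) (hbU : b ⊆ U) (hcU : c ⊆ U) (hdU : d ⊆ U)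
    (hU : #U ≤ 2 * k)
    (habc : ∀ x, x ∈ a → x ∈ b → x ∉ c) (habd : ∀ x, x ∈ a → x ∈ b → x ∉ d)
    (hacd : ∀ x, x ∈ a → x ∈ c → x ∉ d) (hbcd : ∀ x, x ∈ b → x ∈ c → x ∉ d) :
    #U = 2 * k ∧ a ⊆ b ∪ c ∪ d ∧ b ⊆ a ∪ c ∪ d ∧ c ⊆ a ∪ b ∪ d ∧ d ⊆ a ∪ b ∪ c := by
  have hcard : ∀ e : Finset C, e ⊆ U → #e = ∑ x ∈ U, if x ∈ e then 1 else 0 := by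
    intro e he
    rw [← card_filter, filter_mem_eq_inter, inter_eq_right.2 he]
  have htot : #a + #b + #c + #d = ∑ x ∈ U, ((if x ∈ a then 1 else 0) +
      (if x ∈ b then 1 else 0) + (if x ∈ c then 1 else 0) + (if x ∈ d then 1 else 0)) := by
    rw [hcard a haU, hcard b hbU, hcard c hcU, hcard d hdU]
    simp only [sum_add_distrib]
  have hle : ∀ x ∈ U, ((if x ∈ a then 1 else 0) + (if x ∈ b then 1 else 0) +
      (if x ∈ c then 1 else 0) + (if x ∈ d then 1 else 0)) ≤ 2 := by
    intro x _
    have t1 := habc x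
    have t2 := habd x
    have t3 := hacd x
    have t4 := hbcd x
    by_cases h1 : x ∈ a <;> by_cases h2 : x ∈ b <;> by_cases h3 : x ∈ c <;>
      by_cases h4 : x ∈ d <;> simp only [h1, h2, h3, h4, if_true, if_false] <;>
      first | omega | tauto
  have hU2 : #U = 2 * k := by
    have := sum_le_sum hle
    rw [← htot, sum_const, smul_eq_mul] at this
    omega
  have heq : ∀ x ∈ U, ((if x ∈ a then 1 else 0) + (if x ∈ b then 1 else 0) +
      (if x ∈ c then 1 else 0) + (if x ∈ d then 1 else 0)) = 2 := by
    refine (sum_eq_sum_iff_of_le hle).1 ?_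
    rw [← htot, sum_const, smul_eq_mul]
    omega
  refine ⟨hU2, ?_, ?_, ?_, ?_⟩
  all_goals
    intro x hx
    by_contra hcon
    simp only [mem_union, not_or] at hcon
  · simpa [hx, hcon] using heq x (haU hx)
  · simpa [hx, hcon] using heq x (hbU hx)
  · simpa [hx, hcon] using heq x (hcU hx)
  · simpa [hx, hcon] using heq x (hdU hx)

lemma card_eq_sum_card_inter {e f g h : Finset C} (he : e ⊆ f ∪ g ∪ h)
    (h1 : ∀ x, x ∈ e → x ∈ f → x ∉ g) (h2 : ∀ x, x ∈ e → x ∈ f → x ∉ h)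
    (h3 : ∀ x, x ∈ e → x ∈ g → x ∉ h) : #e = #(e ∩ f) + #(e ∩ g) + #(e ∩ h) := by
  rw [← card_union_of_disjoint, ← card_union_of_disjoint]
  · congr 1
    ext x
    have := @he x
    simp only [mem_union, mem_inter] at this ⊢
    tauto
  · rw [disjoint_left]
    intro x
    have := h2 x
    have := h3 x
    simp only [mem_union, mem_inter]
    tauto
  · rw [disjoint_left]
    intro x
    have := h1 x
    simp only [mem_inter]
    tauto

/-- If the lists of the four vertices of a part have size `k`, use at most `2 * k` colors, and no
color lies on three of them, then every color lies on exactly two of them. So opposite pairwise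
intersections have equal sizes, and one of the three ways to pair up the vertices leaves at least
two colors on either side, not all of them in a given set `N` of size `k`. -/
lemma exists_pairing_of_no_triple {a b c d U N : Finset C} {k : ℕ} (ha : #a = k) (hb : #b = k)
    (hc : #c = k) (hd : #d = k) (haU : a ⊆ U) (hbU : b ⊆ U) (hcU : c ⊆ U) (hdU : d ⊆ U)
    (hU : #U ≤ 2 * k) (hk : 2 * k ≤ #U → 6 ≤ k) (hN : #N = k)
    (habc : ∀ x, x ∈ a → x ∈ b → x ∉ c) (habd : ∀ x, x ∈ a → x ∈ b → x ∉ d)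
    (hacd : ∀ x, x ∈ a → x ∈ c → x ∉ d) (hbcd : ∀ x, x ∈ b → x ∈ c → x ∉ d) :
    (2 ≤ #(a ∩ b) ∧ 2 ≤ #(c ∩ d) ∧ ¬ (a ∩ b) ∪ (c ∩ d) ⊆ N) ∨
    (2 ≤ #(a ∩ c) ∧ 2 ≤ #(b ∩ d) ∧ ¬ (a ∩ c) ∪ (b ∩ d) ⊆ N) ∨
    (2 ≤ #(a ∩ d) ∧ 2 ≤ #(b ∩ c) ∧ ¬ (a ∩ d) ∪ (b ∩ c) ⊆ N) := by
  have hdisj₁ : Disjoint (((a ∩ b) ∪ (c ∩ d)) ∩ N) (((a ∩ c) ∪ (b ∩ d)) ∩ N) := by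
    rw [disjoint_left]
    grind
  have hdisj₂ : Disjoint (((a ∩ b) ∪ (c ∩ d)) ∩ N ∪ ((a ∩ c) ∪ (b ∩ d)) ∩ N)
      (((a ∩ d) ∪ (b ∩ c)) ∩ N) := by
    rw [disjoint_left]
    grind
  obtain ⟨hU2, sa, sb, sc, sd⟩ := subset_union_of_no_triple ha hb hc hd haU hbU hcU hdU hU
    habc habd hacd hbcd
  replace sa := card_eq_sum_card_inter sa habc habd hacd
  replace sb := card_eq_sum_card_inter sb (fun x h1 h2 => habc x h2 h1)
    (fun x h1 h2 => habd x h2 h1) hbcd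
  replace sc := card_eq_sum_card_inter sc (fun x h1 h2 h3 => habc x h2 h3 h1)
    (fun x h1 h2 => hacd x h2 h1) (fun x h1 h2 => hbcd x h2 h1)
  replace sd := card_eq_sum_card_inter sd (fun x h1 h2 h3 => habd x h2 h3 h1)
    (fun x h1 h2 h3 => hacd x h2 h3 h1) (fun x h1 h2 h3 => hbcd x h2 h3 h1)
  rw [inter_comm b a] at sb
  rw [inter_comm c a, inter_comm c b] at sc
  rw [inter_comm d a, inter_comm d b, inter_comm d c] at sd
  have hpair : ∀ e f g h : Finset C, (∀ x, x ∈ e → x ∈ f → x ∉ g) →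
      ((e ∩ f) ∪ (g ∩ h) ⊆ N) → #(e ∩ f) + #(g ∩ h) = #(((e ∩ f) ∪ (g ∩ h)) ∩ N) := by
    intro e f g h h1 h2
    rw [inter_eq_left.2 h2, card_union_of_disjoint]
    rw [disjoint_left]
    intro x
    have := h1 x
    simp only [mem_inter]
    tauto
  have hsum : #(((a ∩ b) ∪ (c ∩ d)) ∩ N) + #(((a ∩ c) ∪ (b ∩ d)) ∩ N) +
      #(((a ∩ d) ∪ (b ∩ c)) ∩ N) ≤ #N := by
    rw [← card_union_of_disjoint, ← card_union_of_disjoint]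
    · refine card_le_card fun x => ?_
      simp only [mem_union, mem_inter]
      tauto
    · exact hdisj₂
    · exact hdisj₁
  have p1 := hpair a b c d habc
  have p2 := hpair a c b d (fun x h1 h2 h3 => habc x h1 h3 h2)
  have p3 := hpair a d b c (fun x h1 h2 h3 => habd x h1 h3 h2)
  have hk6 := hk hU2.ge
  by_contra! hcon
  obtain ⟨q1, q2, q3⟩ := hcon
  have e1 : #(a ∩ b) = #(c ∩ d) := by omega
  have e2 : #(a ∩ c) = #(b ∩ d) := by omega
  have e3 : #(a ∩ d) = #(b ∩ c) := by omega
  have r1 : 2 ≤ #(a ∩ b) → #(a ∩ b) + #(c ∩ d) = #(((a ∩ b) ∪ (c ∩ d)) ∩ N) :=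
    fun h => p1 (q1 h (by omega))
  have r2 : 2 ≤ #(a ∩ c) → #(a ∩ c) + #(b ∩ d) = #(((a ∩ c) ∪ (b ∩ d)) ∩ N) :=
    fun h => p2 (q2 h (by omega))
  have r3 : 2 ≤ #(a ∩ d) → #(a ∩ d) + #(b ∩ c) = #(((a ∩ d) ∪ (b ∩ c)) ∩ N) :=
    fun h => p3 (q3 h (by omega))
  omega

end Splitting

/-! ### Hall's condition for the color classes -/

section HallCondition

variable {ι C : Type*} [DecidableEq C]

lemma card_add_card_le_card_biUnion_union {S T : Finset ι} {A B : ι → Finset C} {i : ι}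
    (hi : i ∈ S) (hi' : i ∈ T) (h : Disjoint (A i) (B i)) :
    #(A i) + #(B i) ≤ #(S.biUnion A ∪ T.biUnion B) := by
  rw [← card_union_of_disjoint h]
  exact card_le_card (union_subset_union (subset_biUnion_of_mem A hi) (subset_biUnion_of_mem B hi'))

variable [DecidableEq ι]

/-- Hall's condition for the color classes of the parts. Here `P`, `Q` and `R` are the sets of
parts of size two, three and four, every part `i` in `I` has a class with available colors `A i`,
and every part `i` in `P ∪ Q ∪ R` has a second class with available colors `B i`. If the sets `S`
and `T` of classes see a complete list, then they see `k` colors, while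
`#S + #T ≤ #I + #(S ∩ T) = k + #(S ∩ T)`; so the question is whether the parts in `S ∩ T`, both of
whose classes are chosen, contribute enough additional colors. -/
lemma card_add_card_le_of_classes {I P Q R : Finset ι} {A B : ι → Finset C} {k : ℕ}
    (hI : #I = k) (hPI : P ⊆ I) (hQI : Q ⊆ I) (hRI : R ⊆ I)
    (hfull : ∀ i ∈ I, i ∉ R → k ≤ #(A i))
    (hP : ∀ i ∈ P, k ≤ #(A i) ∧ k ≤ #(B i) ∧ Disjoint (A i) (B i))
    (hQ : ∀ i ∈ Q, k ≤ #(A i) ∧ 2 ≤ #(B i) ∧ Disjoint (A i) (B i))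
    (hQ2 : ∀ y ∈ Q, ∀ z ∈ Q, y ≠ z → k + 3 ≤ #((A y ∪ B y) ∪ (A z ∪ B z)) ∧ 3 ≤ #(B y ∪ B z))
    (hQcard : #Q ≤ 2) (hRcard : #R ≤ 1)
    (hR : ∀ x ∈ R, Disjoint (A x) (B x) ∧ ((k ≤ #(A x) ∧ 1 ≤ #(B x)) ∨
      (2 ≤ #(A x) ∧ 2 ≤ #(B x) ∧ ∃ s ∈ I, s ∉ P ∪ Q ∪ R ∧ ¬ A x ∪ B x ⊆ A s)))
    {S T : Finset ι} (hS : S ⊆ I) (hT : T ⊆ P ∪ Q ∪ R) :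
    #S + #T ≤ #(S.biUnion A ∪ T.biUnion B) := by
  set N := S.biUnion A ∪ T.biUnion B with hN
  have hAN : ∀ i ∈ S, A i ⊆ N := fun i hi => (subset_biUnion_of_mem A hi).trans subset_union_left
  have hBN : ∀ i ∈ T, B i ⊆ N := fun i hi => (subset_biUnion_of_mem B hi).trans subset_union_right
  have hdisj : ∀ i ∈ S, i ∈ T → Disjoint (A i) (B i) → #(A i) + #(B i) ≤ #N :=
    fun i h1 h2 h3 => card_add_card_le_card_biUnion_union h1 h2 h3
  have hTI : T ⊆ I := hT.trans (union_subset (union_subset hPI hQI) hRI)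
  have hsum := card_union_add_card_inter S T
  have hunion : #(S ∪ T) ≤ k := hI ▸ card_le_card (union_subset hS hTI)
  have hScard : #S ≤ k := hI ▸ card_le_card hS
  have hTcard : #T ≤ k := hI ▸ card_le_card hTI
  -- Both classes of a part of size two are chosen.
  by_cases hDP : ∃ i ∈ P, i ∈ S ∧ i ∈ T
  · obtain ⟨i, hiP, hiS, hiT⟩ := hDP
    obtain ⟨h1, h2, h3⟩ := hP i hiP
    have h4 := hdisj i hiS hiT h3
    omega
  push Not at hDP
  rcases le_or_gt k #N with hkN | hkN
  · have hcount : #(S ∩ T) ≤ #(S ∩ T ∩ Q) + #(S ∩ T ∩ R) := by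
      refine (card_le_card fun i hi => ?_).trans (card_union_le _ _)
      obtain ⟨h1, h2⟩ := mem_inter.1 hi
      have h3 := hT h2
      have h4 := fun h => hDP i h h1 h2
      simp only [mem_union, mem_inter] at h3 ⊢
      tauto
    have hb : #(S ∩ T ∩ Q) ≤ 2 := (card_le_card inter_subset_right).trans hQcard
    have ha : #(S ∩ T ∩ R) ≤ 1 := (card_le_card inter_subset_right).trans hRcard
    rcases lt_trichotomy #(S ∩ T ∩ Q) 1 with h0 | h1 | h2
    · rcases (S ∩ T ∩ R).eq_empty_or_nonempty with he | ⟨x, hx⟩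
      · rw [he, card_empty] at hcount
        omega
      simp only [mem_inter] at hx
      obtain ⟨⟨hxS, hxT⟩, hxR⟩ := hx
      obtain ⟨h3, ⟨h4, h5⟩ | ⟨-, -, s, hs, hsJ, h4⟩⟩ := hR x hxR
      · have h6 := hdisj x hxS hxT h3
        omega
      -- All parts meet `S ∪ T`, so the list of the one-vertex part `s` is seen; but the two classes
      -- of the part `x` see a color outside it.
      by_contra! hlt
      have hST : S ∪ T = I :=
        eq_of_subset_of_card_le (union_subset hS hTI) (by omega)
      have hsS : s ∈ S := by
        rcases mem_union.1 (hST.symm ▸ hs) with h | h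
        · exact h
        · exact absurd (hT h) hsJ
      have hsA := hfull s hs fun h => hsJ (mem_union_right _ h)
      have hsN : A s = N := eq_of_subset_of_card_le (hAN s hsS) (by omega)
      exact h4 (hsN ▸ union_subset (hAN x hxS) (hBN x hxT))
    · obtain ⟨y, hy⟩ : (S ∩ T ∩ Q).Nonempty := card_pos.1 (by omega)
      simp only [mem_inter] at hy
      obtain ⟨h3, h4, h5⟩ := hQ y hy.2
      have h6 := hdisj y hy.1.1 hy.1.2 h5
      omega
    · obtain ⟨y, hy, z, hz, hyz⟩ := one_lt_card.1 h2
      simp only [mem_inter] at hy hz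
      have h3 := (hQ2 y hy.2 z hz.2 hyz).1
      have h4 := card_le_card (union_subset (union_subset (hAN y hy.1.1) (hBN y hy.1.2))
        (union_subset (hAN z hz.1.1) (hBN z hz.1.2)))
      omega
  · -- No complete list is seen, so at most four classes are chosen.
    have hSR : ∀ x ∈ S, x ∈ R ∧ Disjoint (A x) (B x) ∧ 2 ≤ #(A x) ∧ 2 ≤ #(B x) := by
      intro x hx
      have h1 := card_le_card (hAN x hx)
      have hxR : x ∈ R := by
        by_contra h
        have := hfull x (hS hx) h
        omega
      obtain ⟨h2, ⟨h3, -⟩ | ⟨h3, h4, -⟩⟩ := hR x hxR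
      · omega
      · exact ⟨hxR, h2, h3, h4⟩
    have hS1 : #S ≤ 1 := (card_le_card fun x hx => (hSR x hx).1).trans hRcard
    have hTQR : #T ≤ #(T ∩ Q) + #(T ∩ R) := by
      refine (card_le_card fun i hi => ?_).trans (card_union_le _ _)
      have h3 := hT hi
      have h4 : i ∉ P := fun h => by
        have := (hP i h).2.1
        have := card_le_card (hBN i hi)
        omega
      simp only [mem_union, mem_inter] at h3 ⊢
      tauto
    have hb : #(T ∩ Q) ≤ 2 := (card_le_card inter_subset_right).trans hQcard
    have ha : #(T ∩ R) ≤ 1 := (card_le_card inter_subset_right).trans hRcard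
    have hb1 : 1 ≤ #(T ∩ Q) → 2 ≤ #N := by
      intro h
      obtain ⟨y, hy⟩ := card_pos.1 h
      rw [mem_inter] at hy
      exact (hQ y hy.2).2.1.trans (card_le_card (hBN y hy.1))
    have hb2 : 2 ≤ #(T ∩ Q) → 3 ≤ #N := by
      intro h
      obtain ⟨y, hy, z, hz, hyz⟩ := one_lt_card.1 h
      rw [mem_inter] at hy hz
      exact (hQ2 y hy.2 z hz.2 hyz).2.trans
        (card_le_card (union_subset (hBN y hy.1) (hBN z hz.1)))
    have ha1 : 1 ≤ #(T ∩ R) → 1 ≤ #N := by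
      intro h
      obtain ⟨x, hx⟩ := card_pos.1 h
      rw [mem_inter] at hx
      have h1 := card_le_card (hBN x hx.1)
      obtain ⟨-, ⟨-, h3⟩ | ⟨-, h3, -⟩⟩ := hR x hx.2 <;> omega
    have hs1 : 1 ≤ #S → 2 ≤ #N := by
      intro h
      obtain ⟨x, hx⟩ := card_pos.1 h
      exact (hSR x hx).2.2.1.trans (card_le_card (hAN x hx))
    have hsa : 1 ≤ #S → 1 ≤ #(T ∩ R) → 4 ≤ #N := by
      intro h h'
      obtain ⟨x, hx⟩ := card_pos.1 h
      obtain ⟨y, hy⟩ := card_pos.1 h'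
      rw [mem_inter] at hy
      obtain ⟨h1, h2, h3, h4⟩ := hSR x hx
      obtain rfl := card_le_one.1 hRcard x h1 y hy.2
      have := hdisj x hx hy.1 h2
      omega
    omega

end HallCondition

/-! ### Complete multipartite graphs with admissible parts -/

section Parts

variable {V ι C : Type*}

lemma exists_classes_of_card_two [DecidableEq V] {P : Finset V} (hP : #P = 2)
    {L : V → Finset C} {k : ℕ} (hk : ∀ v ∈ P, #(L v) = k) (hL : ∀ c, ¬ ∀ v ∈ P, c ∈ L v) :
    ∃ A B, ColoredByPair P L A B ∧ k ≤ #A ∧ k ≤ #B ∧ Disjoint A B := by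
  obtain ⟨x, y, -, rfl⟩ := card_eq_two.1 hP
  refine ⟨L x, L y, ?_, (hk x (by simp)).ge, (hk y (by simp)).ge, ?_⟩
  · intro α hα β hβ v hv
    obtain rfl | rfl : v = x ∨ v = y := by simpa using hv
    · exact .inl hα
    · exact .inr hβ
  · rw [disjoint_left]
    intro c hx hy
    exact hL c (by simp [hx, hy])

variable [DecidableEq C]

/-- The three lists of a part with three vertices, each of which can be colored by splitting off
one vertex. -/
lemma exists_triple_of_card_three [DecidableEq V] {P : Finset V} (hP : #P = 3)
    (L : V → Finset C) :
    ∃ K : Fin 3 → Finset C, (∀ v ∈ P, ∃ i, L v = K i) ∧ (∀ i, ∃ v ∈ P, L v = K i) ∧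
      ∀ i, ColoredByPair P L (K i) (others K i) := by
  obtain ⟨x, y, z, -, -, -, rfl⟩ := card_eq_three.1 hP
  have h : ∀ v ∈ ({x, y, z} : Finset V), ∃ i, L v = (![L x, L y, L z] : Fin 3 → Finset C) i := by
    intro v hv
    obtain rfl | rfl | rfl : v = x ∨ v = y ∨ v = z := by simpa using hv
    exacts [⟨0, rfl⟩, ⟨1, rfl⟩, ⟨2, rfl⟩]
  refine ⟨![L x, L y, L z], h, ?_, ?_⟩
  · intro i
    fin_cases i
    exacts [⟨x, by simp, rfl⟩, ⟨y, by simp, rfl⟩, ⟨z, by simp, rfl⟩]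
  · intro i α hα β hβ v hv
    obtain ⟨j, hj⟩ := h v hv
    rw [hj]
    by_cases hij : j = i
    · exact .inl (hij ▸ hα)
    · exact .inr (mem_others.1 hβ j hij)

/-- Classes for all parts of size three, of which there are at most two. -/
lemma exists_classes_of_card_three [DecidableEq V] [DecidableEq ι] {Q : Finset ι} (hQ : #Q ≤ 2)
    {part : ι → Finset V} (hpart : ∀ i ∈ Q, #(part i) = 3) {L : V → Finset C} {U : Finset C}
    {k : ℕ} (hk : ∀ i ∈ Q, ∀ v ∈ part i, #(L v) = k) (hU : ∀ i ∈ Q, ∀ v ∈ part i, L v ⊆ U)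
    (hL : ∀ i ∈ Q, ∀ c, ¬ ∀ v ∈ part i, c ∈ L v) (hUk : #U + 6 ≤ 3 * k)
    (hk5 : #Q = 2 → 5 ≤ k) :
    ∃ A B : ι → Finset C, (∀ i ∈ Q, ColoredByPair (part i) L (A i) (B i) ∧ k ≤ #(A i) ∧
      2 ≤ #(B i) ∧ Disjoint (A i) (B i)) ∧
      ∀ y ∈ Q, ∀ z ∈ Q, y ≠ z →
        k + 3 ≤ #((A y ∪ B y) ∪ (A z ∪ B z)) ∧ 3 ≤ #(B y ∪ B z) := by
  have hK : ∀ i, ∃ K : Fin 3 → Finset C, i ∈ Q → ((∀ j, #(K j) = k) ∧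
      (∀ c, ¬ ∀ j, c ∈ K j) ∧ 6 ≤ #(others K 0) + #(others K 1) + #(others K 2) ∧
      ∀ j, ColoredByPair (part i) L (K j) (others K j)) := by
    intro i
    by_cases hi : i ∈ Q
    · obtain ⟨K, h1, h2, h3⟩ := exists_triple_of_card_three (hpart i hi) L
      have hKk : ∀ j, #(K j) = k := fun j => by
        obtain ⟨v, hv, he⟩ := h2 j
        exact he ▸ hk i hi v hv
      have hKU : ∀ j, K j ⊆ U := fun j => by
        obtain ⟨v, hv, he⟩ := h2 j
        exact he ▸ hU i hi v hv
      refine ⟨K, fun _ => ⟨hKk, ?_, ?_, h3⟩⟩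
      · intro c hc
        refine hL i hi c fun v hv => ?_
        obtain ⟨j, hj⟩ := h1 v hv
        exact hj ▸ hc j
      · have := le_sum_card_others hKk hKU
        omega
    · exact ⟨fun _ => ∅, fun h => absurd h hi⟩
  choose K hK using hK
  suffices h : ∃ e : ι → Fin 3, (∀ i ∈ Q, 2 ≤ #(others (K i) (e i))) ∧
      ∀ y ∈ Q, ∀ z ∈ Q, y ≠ z → k + 3 ≤ #((K y (e y) ∪ others (K y) (e y)) ∪
        (K z (e z) ∪ others (K z) (e z))) ∧ 3 ≤ #(others (K y) (e y) ∪ others (K z) (e z)) by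
    obtain ⟨e, he1, he2⟩ := h
    refine ⟨fun i => K i (e i), fun i => others (K i) (e i), fun i hi => ?_, he2⟩
    obtain ⟨h1, h2, h3, h4⟩ := hK i hi
    exact ⟨h4 _, (h1 _).ge, he1 i hi, disjoint_others h2 _⟩
  rcases Nat.lt_or_ge #Q 2 with hlt | hge
  · have he : ∀ i, ∃ e : Fin 3, i ∈ Q → 2 ≤ #(others (K i) e) := by
      intro i
      by_cases hi : i ∈ Q
      · obtain ⟨e, he⟩ := exists_two_le_card_others (hK i hi).2.2.1
        exact ⟨e, fun _ => he⟩
      · exact ⟨0, fun h => absurd h hi⟩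
    choose e he using he
    refine ⟨e, he, fun y hy z hz hyz => absurd (card_le_one.1 (by omega) y hy z hz) hyz⟩
  · have hQ2 : #Q = 2 := le_antisymm hQ hge
    obtain ⟨y, z, hyz, rfl⟩ := card_eq_two.1 hQ2
    obtain ⟨h1, h2, h3, -⟩ := hK y (by simp)
    obtain ⟨h1', h2', h3', -⟩ := hK z (by simp)
    obtain ⟨i, j, hi, hj, h4, h5⟩ := exists_split_two_triples h2 h2' (hk5 hQ2) h1 h1' h3 h3'
    have hz : (if z = y then i else j) = j := if_neg hyz.symm
    refine ⟨fun x => if x = y then i else j, ?_, ?_⟩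
    · intro x hx
      obtain rfl | rfl : x = y ∨ x = z := by simpa using hx
      · simpa only [if_true] using hi
      · simpa only [hz] using hj
    · intro a ha b hb hab
      obtain rfl | rfl : a = y ∨ a = z := by simpa using ha
      · obtain rfl | rfl : b = a ∨ b = z := by simpa using hb
        · exact absurd rfl hab
        · simpa only [if_true, hz] using ⟨h4, h5⟩
      · obtain rfl | rfl : b = y ∨ b = a := by simpa using hb
        · simp only [if_true, hz]
          rw [union_comm, union_comm (others (K a) j)]
          exact ⟨h4, h5⟩
        · exact absurd rfl hab

/-- A part of size four is split into a triple with a common color and a single vertex if some color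
lies on three of its lists, and into two pairs otherwise. -/
lemma exists_classes_of_card_four [DecidableEq V] {P : Finset V} (hP : #P = 4)
    {L : V → Finset C} {U N : Finset C} {k : ℕ} (hk : ∀ v ∈ P, #(L v) = k)
    (hU : ∀ v ∈ P, L v ⊆ U) (hL : ∀ c, ¬ ∀ v ∈ P, c ∈ L v) (hUk : #U ≤ 2 * k)
    (hk6 : 2 * k ≤ #U → 6 ≤ k) (hN : #N = k) :
    ∃ A B, ColoredByPair P L A B ∧ Disjoint A B ∧
      ((k ≤ #A ∧ 1 ≤ #B) ∨ (2 ≤ #A ∧ 2 ≤ #B ∧ ¬ A ∪ B ⊆ N)) := by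
  obtain ⟨a, P', -, rfl, hP'⟩ := card_eq_succ.1 hP
  obtain ⟨b, c, d, -, -, -, rfl⟩ := card_eq_three.1 hP'
  have hmem : ∀ v, v ∈ insert a ({b, c, d} : Finset V) ↔ v = a ∨ v = b ∨ v = c ∨ v = d := by simp
  generalize insert a ({b, c, d} : Finset V) = P at *
  simp only [hmem, forall_eq_or_imp, forall_eq] at hk hU hL
  obtain ⟨ka, kb, kc, kd⟩ := hk
  obtain ⟨ua, ub, uc, ud⟩ := hU
  have key : ∀ w, w ∈ P → #(L w) = k → ∀ x, (∀ v ∈ P, v = w ∨ x ∈ L v) →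
      ∃ A B, ColoredByPair P L A B ∧ Disjoint A B ∧
      ((k ≤ #A ∧ 1 ≤ #B) ∨ (2 ≤ #A ∧ 2 ≤ #B ∧ ¬ A ∪ B ⊆ N)) := by
    intro w hw kw x hx
    refine ⟨L w, {x}, ?_, ?_, .inl ⟨kw.ge, by simp⟩⟩
    · intro α hα β hβ v hv
      obtain rfl := mem_singleton.1 hβ
      rcases hx v hv with rfl | h
      · exact .inl hα
      · exact .inr h
    · rw [disjoint_singleton_right]
      intro hxw
      refine hL x ⟨?_, ?_, ?_, ?_⟩
      · rcases hx a ((hmem a).2 (by simp)) with rfl | h <;> assumption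
      · rcases hx b ((hmem b).2 (by simp)) with rfl | h <;> assumption
      · rcases hx c ((hmem c).2 (by simp)) with rfl | h <;> assumption
      · rcases hx d ((hmem d).2 (by simp)) with rfl | h <;> assumption
  by_cases habc : ∀ x, x ∈ L a → x ∈ L b → x ∉ L c
  swap
  · push Not at habc
    obtain ⟨x, h1, h2, h3⟩ := habc
    exact key d ((hmem d).2 (by simp)) kd x fun v hv => by
      rcases (hmem v).1 hv with rfl | rfl | rfl | rfl
      exacts [.inr h1, .inr h2, .inr h3, .inl rfl]
  by_cases habd : ∀ x, x ∈ L a → x ∈ L b → x ∉ L d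
  swap
  · push Not at habd
    obtain ⟨x, h1, h2, h3⟩ := habd
    exact key c ((hmem c).2 (by simp)) kc x fun v hv => by
      rcases (hmem v).1 hv with rfl | rfl | rfl | rfl
      exacts [.inr h1, .inr h2, .inl rfl, .inr h3]
  by_cases hacd : ∀ x, x ∈ L a → x ∈ L c → x ∉ L d
  swap
  · push Not at hacd
    obtain ⟨x, h1, h2, h3⟩ := hacd
    exact key b ((hmem b).2 (by simp)) kb x fun v hv => by
      rcases (hmem v).1 hv with rfl | rfl | rfl | rfl
      exacts [.inr h1, .inl rfl, .inr h2, .inr h3]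
  by_cases hbcd : ∀ x, x ∈ L b → x ∈ L c → x ∉ L d
  swap
  · push Not at hbcd
    obtain ⟨x, h1, h2, h3⟩ := hbcd
    exact key a ((hmem a).2 (by simp)) ka x fun v hv => by
      rcases (hmem v).1 hv with rfl | rfl | rfl | rfl
      exacts [.inl rfl, .inr h1, .inr h2, .inr h3]
  have hpair : ∀ e f g h, (∀ v ∈ P, v = e ∨ v = f ∨ v = g ∨ v = h) →
      (∀ x, x ∈ L e → x ∈ L f → x ∉ L g) →
      2 ≤ #(L e ∩ L f) ∧ 2 ≤ #(L g ∩ L h) ∧ ¬ (L e ∩ L f) ∪ (L g ∩ L h) ⊆ N →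
      ∃ A B, ColoredByPair P L A B ∧ Disjoint A B ∧
        ((k ≤ #A ∧ 1 ≤ #B) ∨ (2 ≤ #A ∧ 2 ≤ #B ∧ ¬ A ∪ B ⊆ N)) := by
    intro e f g h hv h1 h2
    refine ⟨_, _, ?_, ?_, .inr h2⟩
    · intro α hα β hβ v hvP
      rw [mem_inter] at hα hβ
      rcases hv v hvP with rfl | rfl | rfl | rfl <;> simp [hα, hβ]
    · rw [disjoint_left]
      intro x hx hx'
      rw [mem_inter] at hx hx'
      exact h1 x hx.1 hx.2 hx'.1
  rcases exists_pairing_of_no_triple ka kb kc kd ua ub uc ud hUk hk6 hN habc habd hacd hbcd with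
    h | h | h
  · exact hpair a b c d (fun v hv => (hmem v).1 hv) habc h
  · exact hpair a c b d (fun v hv => by have := (hmem v).1 hv; tauto)
      (fun x h1 h2 h3 => habc x h1 h3 h2) h
  · exact hpair a d b c (fun v hv => by have := (hmem v).1 hv; tauto)
      (fun x h1 h2 h3 => habd x h1 h3 h2) h

end Parts

section Main

variable {V ι C : Type*} [Fintype V] [DecidableEq ι]

/-- The part with index `i`. -/
def part (p : V → ι) (i : ι) : Finset V := {v | p v = i}

/-- The vertices of the parts with index in `I`. -/
def verts (p : V → ι) (I : Finset ι) : Finset V := {v | p v ∈ I}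

/-- The indices in `I` of the parts of size `n`. -/
def partsOfSize (p : V → ι) (I : Finset ι) (n : ℕ) : Finset ι := {i ∈ I | #(part p i) = n}

/-- The parts with index in `I` have between one and four vertices, there are exactly three parts of
size one, at most two of size three, and at most one of size four. In contrast to the graphs with
exactly one part of size four and two of size three, this class is closed under deleting a part of
size at least two. -/
structure IsAdmissible (p : V → ι) (I : Finset ι) : Prop where
  one_le : ∀ i ∈ I, 1 ≤ #(part p i)
  le_four : ∀ i ∈ I, #(part p i) ≤ 4
  card_one : #(partsOfSize p I 1) = 3
  card_three : #(partsOfSize p I 3) ≤ 2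
  card_four : #(partsOfSize p I 4) ≤ 1

lemma mem_part {p : V → ι} {i : ι} {v : V} : v ∈ part p i ↔ p v = i := by simp [part]

lemma mem_verts {p : V → ι} {I : Finset ι} {v : V} : v ∈ verts p I ↔ p v ∈ I := by simp [verts]

lemma mem_partsOfSize {p : V → ι} {I : Finset ι} {n : ℕ} {i : ι} :
    i ∈ partsOfSize p I n ↔ i ∈ I ∧ #(part p i) = n := by simp [partsOfSize]

lemma IsAdmissible.erase {p : V → ι} {I : Finset ι} (h : IsAdmissible p I) {i : ι}
    (hi : 2 ≤ #(part p i)) : IsAdmissible p (I.erase i) := by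
  have hsub : ∀ n, partsOfSize p (I.erase i) n ⊆ partsOfSize p I n :=
    fun n => filter_subset_filter _ (erase_subset _ _)
  refine ⟨fun j hj => h.one_le j (mem_of_mem_erase hj),
    fun j hj => h.le_four j (mem_of_mem_erase hj),
    ?_, (card_le_card (hsub 3)).trans h.card_three, (card_le_card (hsub 4)).trans h.card_four⟩
  rw [← h.card_one]
  congr 1
  refine (hsub 1).antisymm fun j hj => ?_
  rw [mem_partsOfSize] at hj ⊢
  refine ⟨mem_erase.2 ⟨?_, hj.1⟩, hj.2⟩
  rintro rfl
  omega

lemma IsAdmissible.card_verts {p : V → ι} {I : Finset ι} (h : IsAdmissible p I) :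
    #(verts p I) + 3 = 2 * #I + #(partsOfSize p I 3) + 2 * #(partsOfSize p I 4) := by
  have h1 : #(verts p I) = ∑ i ∈ I, #(part p i) := by
    rw [card_eq_sum_card_fiberwise (f := p) (t := I) fun v hv => mem_verts.1 hv]
    refine sum_congr rfl fun i hi => ?_
    congr 1
    ext v
    simp only [mem_filter, mem_verts, mem_part]
    exact ⟨fun h => h.2, fun h => ⟨h ▸ hi, h⟩⟩
  suffices #(verts p I) + #(partsOfSize p I 1) =
      2 * #I + #(partsOfSize p I 3) + 2 * #(partsOfSize p I 4) by rwa [h.card_one] at this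
  rw [h1]
  simp only [partsOfSize, card_filter, card_eq_sum_ones I, mul_sum, ← sum_add_distrib]
  refine sum_congr rfl fun i hi => ?_
  have := h.one_le i hi
  have := h.le_four i hi
  interval_cases #(part p i) <;> simp

lemma IsAdmissible.le_card {p : V → ι} {I : Finset ι} (h : IsAdmissible p I) :
    3 + #(partsOfSize p I 3) + #(partsOfSize p I 4) ≤ #I := by
  suffices #(partsOfSize p I 1) + #(partsOfSize p I 3) + #(partsOfSize p I 4) ≤ #I by
    rwa [h.card_one] at this
  simp only [partsOfSize, card_filter, card_eq_sum_ones I, ← sum_add_distrib]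
  refine sum_le_sum fun i hi => ?_
  have := h.one_le i hi
  have := h.le_four i hi
  interval_cases #(part p i) <;> simp

variable [DecidableEq V] [DecidableEq C]

/-- The case in which no color lies on all lists of a part with at least two vertices, and there are
fewer colors than vertices. -/
lemma IsAdmissible.hasListColoring_of_no_common_color [Nonempty C] {p : V → ι} {I : Finset ι}
    (h : IsAdmissible p I) {L : V → Finset C} (hL : ∀ v ∈ verts p I, #(L v) = #I)
    (hU : #((verts p I).biUnion L) < #(verts p I))
    (hcommon : ∀ i ∈ I, 2 ≤ #(part p i) → ∀ c, ¬ ∀ v ∈ part p i, c ∈ L v) :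
    HasListColoring p (verts p I) L := by
  obtain ⟨k, hk⟩ : ∃ k, #I = k := ⟨_, rfl⟩
  rw [hk] at hL
  have hverts := h.card_verts
  have hle := h.le_card
  have hc3 := h.card_three
  have hc4 := h.card_four
  set P := partsOfSize p I 2 with hP
  set Q := partsOfSize p I 3 with hQ
  set R := partsOfSize p I 4 with hR
  set U := (verts p I).biUnion L with hUdef
  -- The numerical side conditions below follow from `#U ≤ 2 * k - 4 + #Q + 2 * #R` and
  -- `3 + #Q + #R ≤ k`; in particular `2 * k ≤ #U` forces `#R = 1` and `#Q = 2`, hence `6 ≤ k`.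
  have hpart : ∀ i ∈ I, ∀ v ∈ part p i, v ∈ verts p I := fun i hi v hv =>
    mem_verts.2 (mem_part.1 hv ▸ hi)
  have hpk : ∀ i ∈ I, ∀ v ∈ part p i, #(L v) = k := fun i hi v hv => hL v (hpart i hi v hv)
  have hpU : ∀ i ∈ I, ∀ v ∈ part p i, L v ⊆ U := fun i hi v hv =>
    subset_biUnion_of_mem L (hpart i hi v hv)
  obtain ⟨s, hs⟩ : (partsOfSize p I 1).Nonempty := card_pos.1 (by rw [h.card_one]; omega)
  rw [mem_partsOfSize] at hs
  obtain ⟨w, hw⟩ := card_eq_one.1 hs.2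
  have hws : w ∈ part p s := hw ▸ mem_singleton_self w
  obtain ⟨A₃, B₃, hAB₃, hAB₃'⟩ := exists_classes_of_card_three (Q := Q) (part := part p) (L := L)
    (U := U) (k := k) hc3 (fun i hi => (mem_partsOfSize.1 hi).2)
    (fun i hi => hpk i (mem_partsOfSize.1 hi).1) (fun i hi => hpU i (mem_partsOfSize.1 hi).1)
    (fun i hi => by
      obtain ⟨h1, h2⟩ := mem_partsOfSize.1 hi
      exact hcommon i h1 (by omega)) (by omega) (by omega)
  have hAB : ∀ i, ∃ A B : Finset C,
      (i ∈ I → #(part p i) = 1 → A = (part p i).biUnion L) ∧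
      (i ∈ P → ColoredByPair (part p i) L A B ∧ k ≤ #A ∧ k ≤ #B ∧ Disjoint A B) ∧
      (i ∈ Q → A = A₃ i ∧ B = B₃ i) ∧
      (i ∈ R → ColoredByPair (part p i) L A B ∧ Disjoint A B ∧
        ((k ≤ #A ∧ 1 ≤ #B) ∨ (2 ≤ #A ∧ 2 ≤ #B ∧ ¬ A ∪ B ⊆ L w))) := by
    intro i
    simp only [hP, hQ, hR, mem_partsOfSize]
    by_cases hi : i ∈ I
    swap
    · exact ⟨∅, ∅, by simp [hi]⟩
    have h1 := h.one_le i hi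
    have h4 := h.le_four i hi
    obtain hn | hn | hn | hn : #(part p i) = 1 ∨ #(part p i) = 2 ∨ #(part p i) = 3 ∨
      #(part p i) = 4 := by omega
    · exact ⟨_, ∅, fun _ _ => rfl, by simp [hn]⟩
    · obtain ⟨A, B, h2⟩ := exists_classes_of_card_two hn (hpk i hi) (hcommon i hi (by omega))
      exact ⟨A, B, by simp [hn], fun _ => h2, by simp [hn], by simp [hn]⟩
    · exact ⟨A₃ i, B₃ i, by simp [hn]⟩
    · have hR1 : 1 ≤ #R := card_pos.2 ⟨i, mem_partsOfSize.2 ⟨hi, hn⟩⟩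
      obtain ⟨A, B, h2⟩ := exists_classes_of_card_four hn (hpk i hi) (hpU i hi)
        (hcommon i hi (by omega)) (by omega) (by omega) (hpk s hs.1 w hws)
      exact ⟨A, B, by simp [hn], by simp [hn], by simp [hn], fun _ => h2⟩
  choose A B hA1 hAP hAQ hAR using hAB
  have hAs : ∀ i ∈ I, ∀ v, part p i = {v} → A i = L v := fun i hi v hv => by
    rw [hA1 i hi (by simp [hv]), hv, singleton_biUnion]
  have hcolored : ∀ i ∈ P ∪ Q ∪ R, ColoredByPair (part p i) L (A i) (B i) := by
    intro i hi
    rcases mem_union.1 hi with hi | hi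
    · rcases mem_union.1 hi with hi | hi
      · exact (hAP i hi).1
      · rw [(hAQ i hi).1, (hAQ i hi).2]
        exact (hAB₃ i hi).1
    · exact (hAR i hi).1
  have hone : ∀ i ∈ I, i ∉ P ∪ Q ∪ R → ∃ v, part p i = {v} := by
    intro i hi hn
    simp only [hP, hQ, hR, mem_union, mem_partsOfSize, hi, true_and] at hn
    have := h.one_le i hi
    have := h.le_four i hi
    exact card_eq_one.1 (by omega)
  have hsJ : s ∉ P ∪ Q ∪ R := by
    simp [hP, hQ, hR, mem_partsOfSize, hs.2]
  have hQ' : ∀ i ∈ Q, k ≤ #(A i) ∧ 2 ≤ #(B i) ∧ Disjoint (A i) (B i) := by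
    intro i hi
    rw [(hAQ i hi).1, (hAQ i hi).2]
    exact (hAB₃ i hi).2
  obtain ⟨f, g, hf, hg, hfinj, hginj, hfg⟩ := exists_transversal_of_hall I (P ∪ Q ∪ R) A B
    fun S hS T hT => card_add_card_le_of_classes (Q := Q) (R := R) hk (filter_subset _ _)
      (filter_subset _ _) (filter_subset _ _)
      (fun i hi hiR => by
        by_cases hiJ : i ∈ P ∪ Q ∪ R
        · rcases mem_union.1 hiJ with hiJ | hiJ
          · rcases mem_union.1 hiJ with hiJ | hiJ
            · exact (hAP i hiJ).2.1
            · exact (hQ' i hiJ).1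
          · exact absurd hiJ hiR
        · obtain ⟨v, hv⟩ := hone i hi hiJ
          rw [hAs i hi v hv]
          exact (hpk i hi v (hv ▸ mem_singleton_self v)).ge)
      (fun i hi => (hAP i hi).2) hQ'
      (fun y hy z hz hyz => by
        rw [(hAQ y hy).1, (hAQ y hy).2, (hAQ z hz).1, (hAQ z hz).2]
        exact hAB₃' y hy z hz hyz)
      hc3 hc4
      (fun x hx => ⟨(hAR x hx).2.1, (hAR x hx).2.2.imp_right fun h2 =>
        ⟨h2.1, h2.2.1, s, hs.1, hsJ, by rw [hAs s hs.1 w hw]; exact h2.2.2⟩⟩) hS hT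
  refine ⟨fun v => if f (p v) ∈ L v then f (p v) else g (p v), ?_, ?_⟩
  · intro v hv
    have hi := mem_verts.1 hv
    dsimp only
    split_ifs with hfv
    · exact hfv
    · by_cases hJ : p v ∈ P ∪ Q ∪ R
      · exact (hcolored _ hJ _ (hf _ hi) _ (hg _ hJ) v (mem_part.2 rfl)).resolve_left hfv
      · obtain ⟨u, hu⟩ := hone _ hi hJ
        obtain rfl : v = u := mem_singleton.1 (hu ▸ mem_part.2 rfl)
        exact absurd (hAs _ hi v hu ▸ hf _ hi) hfv
  · have hJ : ∀ v ∈ verts p I, f (p v) ∉ L v → p v ∈ P ∪ Q ∪ R := by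
      intro v hv hfv
      by_contra hJ
      have hi := mem_verts.1 hv
      obtain ⟨u, hu⟩ := hone _ hi hJ
      obtain rfl : v = u := mem_singleton.1 (hu ▸ mem_part.2 rfl)
      exact hfv (hAs _ hi v hu ▸ hf _ hi)
    intro u hu v hv huv
    have hui := mem_verts.1 hu
    have hvi := mem_verts.1 hv
    dsimp only
    split_ifs with h1 h2 h2
    · exact fun he => huv (hfinj hui hvi he)
    · exact hfg _ hui _ (hJ v hv h2)
    · exact (hfg _ hvi _ (hJ u hu h1)).symm
    · exact fun he => huv (hginj (hJ u hu h1) (hJ v hv h2) he)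

/-- Graphs with admissible parts are colorable from lists of size at least the number of parts. -/
theorem IsAdmissible.hasListColoring [Nonempty C] {p : V → ι} {I : Finset ι}
    (h : IsAdmissible p I) (L : V → Finset C) (hL : ∀ v ∈ verts p I, #I ≤ #(L v)) :
    HasListColoring p (verts p I) L := by
  induction hn : #I generalizing I L with
  | zero =>
    have := h.le_card
    omega
  | succ n ih =>
    have hsub : ∀ v, ∃ t ⊆ L v, v ∈ verts p I → #t = #I := fun v => by
      by_cases hv : v ∈ verts p I
      · obtain ⟨t, ht, hc⟩ := exists_subset_card_eq (hL v hv)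
        exact ⟨t, ht, fun _ => hc⟩
      · exact ⟨∅, empty_subset _, fun h => absurd h hv⟩
    choose L₀ hL₀ hL₀' using hsub
    refine HasListColoring.mono ?_ fun v _ => hL₀ v
    refine hasListColoring_of_few_colors p _ #I ?_ L₀ hL₀'
    clear! L L₀
    intro L hL hU
    by_cases hcommon : ∀ i ∈ I, 2 ≤ #(part p i) → ∀ c, ¬ ∀ v ∈ part p i, c ∈ L v
    · exact h.hasListColoring_of_no_common_color hL hU hcommon
    -- Use a common color of a part on that part, and nowhere else.
    push Not at hcommon
    obtain ⟨i, hi, hi2, c, hc⟩ := hcommon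
    have hcard : #(I.erase i) = n := by rw [card_erase_of_mem hi, hn]; rfl
    obtain ⟨f, hf, hfp⟩ := ih (h.erase hi2) (fun v => (L v).erase c) (by
      intro v hv
      have h1 := hL v (mem_verts.2 (mem_of_mem_erase (mem_verts.1 hv)))
      have h2 := pred_card_le_card_erase (s := L v) (a := c)
      omega) hcard
    have hmem : ∀ v ∈ verts p I, p v ≠ i → v ∈ verts p (I.erase i) := fun v hv hvi =>
      mem_verts.2 (mem_erase.2 ⟨hvi, mem_verts.1 hv⟩)
    refine ⟨fun v => if p v = i then c else f v, ?_, ?_⟩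
    · intro v hv
      dsimp only
      split_ifs with hvi
      · exact hc v (mem_part.2 hvi)
      · exact mem_of_mem_erase (hf v (hmem v hv hvi))
    · intro u hu v hv huv
      dsimp only
      split_ifs with h1 h2 h2
      · exact absurd (h1.trans h2.symm) huv
      · exact (ne_of_mem_erase (hf v (hmem v hv h2))).symm
      · exact ne_of_mem_erase (hf u (hmem u hu h1))
      · exact hfp u (hmem u hu h1) v (hmem v hv h2) huv

end Main

/-! ### The choice number -/

section ChoiceNumber

open SimpleGraph

lemma card_part_sigma_fst {ι : Type*} [Fintype ι] [DecidableEq ι] (s : ι → ℕ) (i : ι) :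
    #(part (Sigma.fst : (Σ i, Fin (s i)) → ι) i) = s i := by
  have : part (Sigma.fst : (Σ i, Fin (s i)) → ι) i =
      univ.map (Function.Embedding.sigmaMk (β := fun i => Fin (s i)) i) := by
    ext ⟨j, x⟩
    simp only [mem_part, mem_map, mem_univ, true_and, Function.Embedding.sigmaMk_apply]
    constructor
    · rintro rfl
      exact ⟨x, rfl⟩
    · rintro ⟨y, hy⟩
      exact (congrArg Sigma.fst hy).symm
  rw [this, card_map, card_univ, Fintype.card_fin]

lemma card_filter_get_eq_count (l : List ℕ) (a : ℕ) :
    #{i : Fin l.length | l.get i = a} = l.count a :=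
  Fin.card_filter_univ_eq_vector_get_eq_count a (⟨l, rfl⟩ : List.Vector ℕ l.length)

/-- A complete multipartite graph with nonempty parts contains a clique that meets every part, so it
cannot be colored from constant lists with fewer colors than parts. -/
lemma length_le_of_choosable {l : List ℕ} (hl : ∀ n ∈ l, 1 ≤ n) {k : ℕ}
    (h : (completeMultipartiteOfSizes l).Choosable k) : l.length ≤ k := by
  obtain ⟨c, -⟩ := h (Fin k) (fun _ => univ) (by simp)
  have hpos : ∀ i : Fin l.length, 0 < l.get i := fun i => hl _ (l.get_mem i)
  have hinj : Function.Injective fun i : Fin l.length => c ⟨i, ⟨0, hpos i⟩⟩ := by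
    intro i j hij
    by_contra hne
    exact c.valid (v := ⟨i, ⟨0, hpos i⟩⟩) (w := ⟨j, ⟨0, hpos j⟩⟩) hne hij
  simpa using Fintype.card_le_of_injective _ hinj

lemma choosable_of_length_eq {l : List ℕ} (hl : ∀ n ∈ l, 1 ≤ n ∧ n ≤ 4) (h1 : l.count 1 = 3)
    (h3 : l.count 3 ≤ 2) (h4 : l.count 4 ≤ 1) {k : ℕ} (hk : l.length = k) :
    (completeMultipartiteOfSizes l).Choosable k := by
  classical
  subst hk
  intro C L hL
  let p : (Σ i : Fin l.length, Fin (l.get i)) → Fin l.length := Sigma.fst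
  have hpart : ∀ i, #(part p i) = l.get i := card_part_sigma_fst l.get
  have hsize : ∀ n, #(partsOfSize p univ n) = l.count n := fun n => by
    simp only [partsOfSize, hpart]
    exact card_filter_get_eq_count l n
  have hadm : IsAdmissible p univ :=
    ⟨fun i _ => hpart i ▸ (hl _ (l.get_mem i)).1, fun i _ => hpart i ▸ (hl _ (l.get_mem i)).2,
      (hsize 1).trans h1, (hsize 3).le.trans h3, (hsize 4).le.trans h4⟩
  have hlen : 0 < l.length := by
    have := l.count_le_length (a := 1)
    omega
  have : Nonempty C := by
    obtain ⟨c, -⟩ := card_pos.1 (hlen.trans_le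
      (hL ⟨⟨0, hlen⟩, ⟨0, (hl _ (l.get_mem ⟨0, hlen⟩)).1⟩⟩))
    exact ⟨c⟩
  obtain ⟨c, hc, hp⟩ := hadm.hasListColoring L fun v _ => by simpa using hL v
  have hv : ∀ v, v ∈ verts p univ := fun v => mem_verts.2 (mem_univ _)
  exact ⟨Coloring.mk c fun {u v} huv => hp u (hv u) v (hv v) huv, fun v => hc v (hv v)⟩

end ChoiceNumber

end ListColoring

theorem theorem1 (k : ℕ) (hk : 6 ≤ k) :
    (SimpleGraph.completeMultipartiteOfSizes
      ([4] ++ List.replicate 2 3 ++ List.replicate (k - 6) 2 ++ List.replicate 3 1)).choiceNumber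
      = (k : ℕ∞) := by
  have hlen : ([4] ++ List.replicate 2 3 ++ List.replicate (k - 6) 2 ++
      List.replicate 3 1).length = k := by
    simp only [List.length_append, List.length_replicate, List.length_singleton]
    omega
  have hmem : ∀ n ∈ [4] ++ List.replicate 2 3 ++ List.replicate (k - 6) 2 ++ List.replicate 3 1,
      1 ≤ n ∧ n ≤ 4 := by
    intro n hn
    simp only [List.mem_append, List.mem_singleton, List.mem_replicate] at hn
    omega
  refine le_antisymm ?_ ?_
  · refine iInf₂_le k ?_
    exact ListColoring.choosable_of_length_eq hmem
      (by simp [List.count_append, List.count_replicate])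
      (by simp [List.count_append, List.count_replicate])
      (by simp [List.count_append, List.count_replicate]) hlen
  · refine le_iInf₂ fun m hm => ?_
    have := ListColoring.length_le_of_choosable (fun n hn => (hmem n hn).1) hm
    rw [hlen] at this
    exact_mod_cast this
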